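/- Let $G=(V,E)$ be a connected undirected simple graph on $V=\{1,\dots,p\}$, $p\ge 3$. For $\mathbf x\in\mathbb R^p$ let $\nabla\mathbf x=(x_i-x_j:(i,j)\in E)\in\mathbb R^{|E|}$ (with an arbitrary fixed orientation of each edge), and let $\|\nabla\mathbf x\|_0$ be its number of nonzero entries. For $\kappa>0$ and a function $\rho:[0,\infty)\to[0,\infty)$ that is twice differentiable on $(0,\infty)$ with $\rho'(s)\ge 0$ and $\rho''(s)\le 0$ for all $s>0$, a matrix $\mathbf A\in\mathbb R^{n\times p}$ satisfies the $(\kappa,\rho)$-cut-restricted isometry property ($(\kappa,\rho)$-cRIP) if for every $\mathbf x\in\mathbb R^p$ with $\|\nabla\mathbf x\|_0\ge 1$, \[\left(1-\kappa-\sqrt{\rho(\|\nabla\mathbf x\|_0)}\right)\|\mathbf x\|_2\le\|\mathbf A\mathbf x\|_2\le\left(1+\kappa+\sqrt{\rho(\|\nabla\mathbf x\|_0)}\right)\|\mathbf x\|_2 .\] For a random vector $\mathbf a\in\mathbb R^p$ let \[\|\mathbf a\|_{\psi_2}=\sup_{\mathbf u:\|\mathbf u\|_2=1}\ \sup_{q\ge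 1}\ q^{-1/2}\,\mathbb E\big[|\mathbf u^{\mathsf T}\mathbf a|^q\big]^{1/q}.\] Proposition 1. Let $K>0$, $\kappa\in(0,1)$ and $k>0$. There is a constant $C>0$ depending only on $K,\kappa,k$ such that the following holds for all $n\ge 1$, all $p\ge 3$ and every connected graph $G$ on $\{1,\dots,p\}$. Let $\mathbf A\in\mathbb R^{n\times p}$ have rows $\mathbf a_i/\sqrt n$, where $\mathbf a_1,\dots,\mathbf a_n$ are i.i.d. random vectors in $\mathbb R^p$ with mean zero, covariance $\operatorname{Cov}[\mathbf a_i]=\mathbf\Sigma$ and $\|\mathbf a_i\|_{\psi_2}\le K$, and suppose that all eigenvalues of $\mathbf\Sigma$ lie in $[(1-\kappa)^2,(1+\kappa)^2]$. Then with probability at least $1-|E|^{-k}$, the matrix $\mathbf A$ satisfies $(\kappa,\rho)$-cRIP for the function \[\rho(s)=\frac{C\,s\log(1+|E|/s)}{n}\qquad(s>0),\qquad \rho(0)=0 .\] -/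

import Mathlib

open MeasureTheory ProbabilityTheory
open scoped ENNReal

/-- The discrete gradient `∇ x = (x_i - x_j : (i,j) ∈ E)` of a signal on the vertices of `G`;
each undirected edge is oriented with its smaller endpoint first. -/
def discreteGradient {p : ℕ} (G : SimpleGraph (Fin p)) (x : EuclideanSpace ℝ (Fin p)) :
    G.edgeSet → ℝ :=
  fun e => x (Sym2.inf e.1) - x (Sym2.sup e.1)

/-- The gradient sparsity `‖∇ x‖₀`: the number of nonzero entries of `∇ x`. -/
noncomputable def gradientSparsity {p : ℕ} (G : SimpleGraph (Fin p))
    (x : EuclideanSpace ℝ (Fin p)) : ℕ :=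
  (Function.support (discreteGradient G x)).ncard

/-- `A` satisfies the `(κ, ρ)`-cut-restricted isometry property for the graph `G`. The first six
fields are the requirements on the pair `(κ, ρ)`: `κ > 0`, and `ρ : [0, ∞) → [0, ∞)` has
`ρ' ≥ 0` and `ρ'' ≤ 0` on `(0, ∞)` (only the values of `ρ` on `[0, ∞)` matter). -/
structure IsCutRIP {n p : ℕ} (G : SimpleGraph (Fin p)) (A : Matrix (Fin n) (Fin p) ℝ)
    (κ : ℝ) (ρ : ℝ → ℝ) : Prop where
  kappa_pos : 0 < κ
  rho_nonneg : ∀ s, 0 ≤ s → 0 ≤ ρ s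
  rho_differentiable : ∀ s, 0 < s → DifferentiableAt ℝ ρ s
  rho_deriv_differentiable : ∀ s, 0 < s → DifferentiableAt ℝ (deriv ρ) s
  rho_deriv_nonneg : ∀ s, 0 < s → 0 ≤ deriv ρ s
  rho_deriv_deriv_nonpos : ∀ s, 0 < s → deriv (deriv ρ) s ≤ 0
  bounds : ∀ x : EuclideanSpace ℝ (Fin p), 1 ≤ gradientSparsity G x →
    (1 - κ - √(ρ (gradientSparsity G x))) * ‖x‖ ≤ ‖Matrix.toEuclideanLin A x‖ ∧
    ‖Matrix.toEuclideanLin A x‖ ≤ (1 + κ + √(ρ (gradientSparsity G x))) * ‖x‖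

/-- The sub-Gaussian norm
`‖a‖_{ψ₂} = sup_{‖u‖₂ = 1} sup_{q ≥ 1} q^{-1/2} (𝔼 |uᵀ a|^q)^{1/q}` of a random vector,
as an extended nonnegative real. -/
noncomputable def subGaussianNorm {Ω : Type*} [MeasurableSpace Ω] {p : ℕ}
    (a : Ω → EuclideanSpace ℝ (Fin p)) (μ : Measure Ω) : ℝ≥0∞ :=
  ⨆ (u : EuclideanSpace ℝ (Fin p)) (_ : ‖u‖ = 1) (q : ℝ) (_ : 1 ≤ q),
    ENNReal.ofReal (q ^ (-(1 / 2) : ℝ)) *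
      eLpNorm (fun ω => inner ℝ u (a ω)) (ENNReal.ofReal q) μ

/-- The covariance matrix of a random vector. -/
noncomputable def covarianceMatrix {Ω : Type*} [MeasurableSpace Ω] {p : ℕ}
    (a : Ω → EuclideanSpace ℝ (Fin p)) (μ : Measure Ω) : Matrix (Fin p) (Fin p) ℝ :=
  Matrix.of fun i j => cov[fun ω => a ω i, fun ω => a ω j; μ]

/-- The `n × p` design matrix with rows `aᵢ / √n`. -/
noncomputable def designMatrix {n p : ℕ} (a : Fin n → EuclideanSpace ℝ (Fin p)) :
    Matrix (Fin n) (Fin p) ℝ :=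
  Matrix.of fun i j => a i j / √(n : ℝ)

/-!
For `m = |E|` and the quadratic form `q x = ‖A x‖² - xᵀ Σ x`, it is enough to bound `|q|` by a
constant multiple of `max η (η²)`, with `η² = (k + 16) s log (1 + m / s) / n`, at all unit vectors of gradient
sparsity `s`: the spectrum of `Σ` lies in `[(1 - κ)², (1 + κ)²]`, so taking square roots turns this
into the cut-restricted isometry bounds with `√ρ` a constant multiple of `η`
(`bounds_of_abs_sq_sub_le`).

A signal of gradient sparsity `s` lies in one of `m.choose s` subspaces, those of signals whose
gradient is supported on a given set `F` of `s` edges. Since the graph is connected, such a subspace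
has dimension at most `s + 1` (`finrank_cutSpace_le`), so its unit sphere has a `1 / 2`-net of at
most `5 ^ (s + 1)` points (`exists_half_net_unit_sphere`), and a bound for `|q|` on the net holds up
to a factor `2` on the sphere (`abs_bilinForm_self_le_of_net`).

For one unit vector `y`, `n q y` is a sum of independent centred variables `⟨y, aᵢ⟩² - yᵀ Σ y`. The
sub-Gaussian norm bounds the moments of `⟨y, aᵢ⟩²` by `j! Lʲ` with `L = 2 e K²`, so Bernstein's
inequality gives `|q y| < 4 L max η (η²)` except with probability `2 exp (-n η²)`
(`measureReal_sum_sub_ge_le`). A union bound over all `F` and all net points concludes, because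
`m.choose s * 5 ^ (s + 1) * 2 exp (-n η²) ≤ m ^ (-(k + 1))` for each of the `m` values of `s`
(`choose_mul_exp_le`).
-/

/-! ### Nets of the unit sphere and quadratic forms -/

/-- A set of unit vectors with pairwise distances at least `1 / 2`, of the largest possible
cardinality, is a net; doubled, it is a `1`-separated set in the ball of radius `2`, which has at
most `5 ^ finrank` points. -/
theorem exists_half_net_unit_sphere (E : Type*) [NormedAddCommGroup E] [NormedSpace ℝ E]
    [FiniteDimensional ℝ E] :
    ∃ N : Finset E, (∀ y ∈ N, ‖y‖ = 1) ∧ N.card ≤ 5 ^ Module.finrank ℝ E ∧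
      ∀ x : E, ‖x‖ = 1 → ∃ y ∈ N, ‖x - y‖ ≤ 1 / 2 := by
  classical
  let Sep : Finset E → Prop := fun N => (∀ y ∈ N, ‖y‖ = 1) ∧
    ∀ c ∈ N, ∀ d ∈ N, c ≠ d → 1 / 2 ≤ ‖c - d‖
  have hcard : ∀ N, Sep N → N.card ≤ 5 ^ Module.finrank ℝ E := by
    rintro N ⟨h1, h2⟩
    have hinj : Function.Injective (fun y : E => (2 : ℝ) • y) :=
      smul_right_injective E two_ne_zero
    rw [← Finset.card_image_of_injective N hinj]
    apply Besicovitch.card_le_of_separated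
    · intro c hc
      obtain ⟨y, hy, rfl⟩ := Finset.mem_image.1 hc
      simp [norm_smul, h1 y hy]
    · intro c hc d hd hcd
      obtain ⟨y, hy, rfl⟩ := Finset.mem_image.1 hc
      obtain ⟨z, hz, rfl⟩ := Finset.mem_image.1 hd
      have := h2 y hy z hz fun h => hcd (by rw [h])
      rw [← smul_sub, norm_smul, Real.norm_ofNat]
      linarith
  obtain ⟨n, ⟨N, hN, rfl⟩, hmax⟩ : ∃ n, (∃ N, Sep N ∧ N.card = n) ∧
      ∀ m, (∃ N, Sep N ∧ N.card = m) → m ≤ n := by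
    have hne : {n | ∃ N, Sep N ∧ N.card = n}.Nonempty := ⟨0, ∅, by simp [Sep], rfl⟩
    have hbdd : BddAbove {n | ∃ N, Sep N ∧ N.card = n} :=
      ⟨5 ^ Module.finrank ℝ E, by rintro _ ⟨N, hN, rfl⟩; exact hcard N hN⟩
    exact ⟨_, Nat.sSup_mem hne hbdd, fun m hm => le_csSup hbdd hm⟩
  refine ⟨N, hN.1, hcard N hN, fun x hx => ?_⟩
  by_contra! hcon
  have hxN : x ∉ N := fun h => by have := hcon x h; norm_num at this
  have hins : Sep (insert x N) := by
    refine ⟨fun y hy => ?_, fun c hc d hd hcd => ?_⟩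
    · rcases Finset.mem_insert.1 hy with rfl | hy
      exacts [hx, hN.1 y hy]
    · rcases Finset.mem_insert.1 hc with rfl | hc <;> rcases Finset.mem_insert.1 hd with rfl | hd
      · exact absurd rfl hcd
      · exact (hcon d hd).le
      · rw [norm_sub_rev]; exact (hcon c (by assumption)).le
      · exact hN.2 c hc d hd hcd
  have := hmax _ ⟨_, hins, rfl⟩
  rw [Finset.card_insert_of_notMem hxN] at this
  omega

section
variable {E : Type*} [NormedAddCommGroup E] [InnerProductSpace ℝ E]

/-- A form bounded by `M ‖·‖²` that attains this bound at a unit vector `x` is at least `M / 2` at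
every unit vector within `1 / 2` of `x`: the nonnegative form `M ‖v‖² - B v v` vanishes at `x`, so
its value at `x + h` is its value at `h`. -/
theorem half_le_of_isMax_of_norm_sub_le (B : LinearMap.BilinForm ℝ E) {M : ℝ}
    (hM : ∀ v, |B v v| ≤ M * ‖v‖ ^ 2) {x y : E} (hx : ‖x‖ = 1) (hxM : B x x = M) (hy : ‖y‖ = 1)
    (hxy : ‖x - y‖ ≤ 1 / 2) : M / 2 ≤ B y y := by
  set h : E := y - x with hh
  have hM0 : 0 ≤ M := by have := (abs_nonneg _).trans (hM x); simpa [hx] using this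
  have hexp : ∀ t : ℝ, 0 ≤ (M * ‖h‖ ^ 2 - B h h) * (t * t) +
      (2 * M * inner ℝ x h - (B x h + B h x)) * t + 0 := by
    intro t
    have h1 := (abs_le.1 (hM (x + t • h))).2
    rw [norm_add_sq_real, norm_smul, mul_pow, inner_smul_right, hx, Real.norm_eq_abs, sq_abs] at h1
    simp only [map_add, map_smul, LinearMap.add_apply, LinearMap.smul_apply, smul_eq_mul,
      hxM] at h1
    linarith
  -- A polynomial `α t² + β t` that is nonnegative for all `t` has `β = 0`.
  have hlin : 2 * M * inner ℝ x h - (B x h + B h x) = 0 := by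
    have := discrim_le_zero hexp
    simpa [discrim] using this.antisymm (by simpa [discrim] using sq_nonneg _)
  have hyB : B y y = M + (B x h + B h x) + B h h := by
    have : y = x + h := by simp [hh]
    rw [this]
    simp only [map_add, LinearMap.add_apply, hxM]
    ring
  have hyn : 1 = 1 + 2 * inner ℝ x h + ‖h‖ ^ 2 := by
    have h2 := norm_add_sq_real x h
    rw [show x + h = y by simp [hh], hx, hy] at h2
    linarith
  have hhn : ‖h‖ ^ 2 ≤ 1 / 4 := by
    rw [hh, norm_sub_rev]
    nlinarith [norm_nonneg (x - y)]
  have hBh := (abs_le.1 (hM h)).1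
  have : M * (2 * inner ℝ x h) = - (M * ‖h‖ ^ 2) := by
    rw [show 2 * inner ℝ x h = - ‖h‖ ^ 2 by linarith]; ring
  nlinarith

theorem abs_bilinForm_self_le_of_net [FiniteDimensional ℝ E] (B : LinearMap.BilinForm ℝ E)
    {N : Finset E} (hN : ∀ y ∈ N, ‖y‖ = 1)
    (hnet : ∀ x : E, ‖x‖ = 1 → ∃ y ∈ N, ‖x - y‖ ≤ 1 / 2) {t : ℝ} (ht : ∀ y ∈ N, |B y y| ≤ t)
    {x : E} (hx : ‖x‖ = 1) : |B x x| ≤ 2 * t := by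
  have hcont : Continuous fun v : E => |B v v| := by
    have : Continuous fun v : E => B v v := by
      have h1 : Continuous fun v : E => LinearMap.toContinuousLinearMap (B v) :=
        (LinearMap.toContinuousLinearMap.toLinearMap ∘ₗ B).continuous_of_finiteDimensional
      exact h1.clm_apply continuous_id
    exact this.abs
  obtain ⟨x₀, hx₀, hmax⟩ := (isCompact_sphere (0 : E) 1).exists_isMaxOn ⟨x, by simpa using hx⟩
    hcont.continuousOn
  have hx₀' : ‖x₀‖ = 1 := by simpa using hx₀
  set M := |B x₀ x₀| with hMdef
  have hM : ∀ v, |B v v| ≤ M * ‖v‖ ^ 2 := by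
    intro v
    rcases eq_or_ne v 0 with rfl | hv
    · simp
    have hv' : 0 < ‖v‖ := norm_pos_iff.2 hv
    have := hmax (a := ‖v‖⁻¹ • v) (by simp [norm_smul, hv'.ne'])
    simp only [map_smul, LinearMap.smul_apply, smul_eq_mul, Set.mem_ofPred_eq] at this
    rw [← mul_assoc, abs_mul, abs_of_nonneg (by positivity)] at this
    calc |B v v| = (‖v‖⁻¹ * ‖v‖⁻¹ * |B v v|) * ‖v‖ ^ 2 := by field_simp
      _ ≤ M * ‖v‖ ^ 2 := by gcongr
  obtain ⟨y, hy, hxy⟩ := hnet x₀ hx₀'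
  have key : M / 2 ≤ |B y y| := by
    rcases abs_choice (B x₀ x₀) with h | h
    · exact (half_le_of_isMax_of_norm_sub_le B hM hx₀' (hMdef.trans h).symm (hN y hy) hxy).trans
        (le_abs_self _)
    · have := half_le_of_isMax_of_norm_sub_le (-B) (M := M) (by simpa using hM) hx₀'
        (by simp [hMdef, h]) (hN y hy) hxy
      exact this.trans (by simpa using neg_le_abs (B y y))
  have h1 := hmax (a := x) (by simpa using hx)
  have h2 := ht y hy
  simp only [Set.mem_ofPred_eq] at h1
  linarith
end

/-! ### Bernstein's inequality for squares of sub-Gaussian variables -/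

section
variable {Ω : Type*} [MeasurableSpace Ω] {μ : Measure Ω} [IsProbabilityMeasure μ]

/-- Factorial moments `𝔼 Zʲ ≤ j! Lʲ` give a sub-exponential moment generating function. The mean
enters exactly, so the bound is quadratic in `t` for the centred variable. -/
theorem integrable_exp_mul_and_mgf_le_of_moments {Z : Ω → ℝ} (hZ : Measurable Z)
    (hZ0 : ∀ ω, 0 ≤ Z ω) {L : ℝ} (hint : ∀ j : ℕ, Integrable (fun ω => Z ω ^ j) μ)
    (hmom : ∀ j : ℕ, ∫ ω, Z ω ^ j ∂μ ≤ j.factorial * L ^ j)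
    {t : ℝ} (ht : L * |t| ≤ 1 / 2) (hL : 0 ≤ L) :
    Integrable (fun ω => Real.exp (t * Z ω)) μ ∧
      mgf Z μ t ≤ Real.exp (t * ∫ ω, Z ω ∂μ + 2 * (L * t) ^ 2) := by
  -- The terms of the exponential series, integrated, are dominated by a geometric series.
  have key : ∀ t : ℝ, L * |t| ≤ 1 / 2 →
      HasSum (fun j : ℕ => t ^ j / j.factorial * ∫ ω, Z ω ^ j ∂μ) (mgf Z μ t) ∧
      ∀ j : ℕ, |t ^ j / j.factorial * ∫ ω, Z ω ^ j ∂μ| ≤ (L * |t|) ^ j := by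
    intro t ht
    have hb : ∀ j : ℕ, |t| ^ j / j.factorial * ∫ ω, Z ω ^ j ∂μ ≤ (L * |t|) ^ j := by
      intro j
      have hj : (0 : ℝ) < j.factorial := by exact_mod_cast j.factorial_pos
      calc |t| ^ j / j.factorial * ∫ ω, Z ω ^ j ∂μ
          ≤ |t| ^ j / j.factorial * (j.factorial * L ^ j) := by gcongr; exact hmom j
        _ = (L * |t|) ^ j := by rw [mul_pow]; field_simp
    have hnn : ∀ j : ℕ, 0 ≤ ∫ ω, Z ω ^ j ∂μ := fun j =>
      integral_nonneg fun ω => pow_nonneg (hZ0 ω) j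
    have habs : ∀ j : ℕ, |t ^ j / j.factorial * ∫ ω, Z ω ^ j ∂μ| =
        |t| ^ j / j.factorial * ∫ ω, Z ω ^ j ∂μ := by
      intro j
      rw [abs_mul, abs_div, abs_pow, Nat.abs_cast, abs_of_nonneg (hnn j)]
    refine ⟨?_, fun j => (habs j).trans_le (hb j)⟩
    have hsum := hasSum_integral_of_summable_integral_norm (μ := μ)
      (F := fun (j : ℕ) ω => t ^ j / j.factorial * Z ω ^ j) (fun j => (hint j).const_mul _) (by
        refine Summable.of_nonneg_of_le (fun j => integral_nonneg fun ω => norm_nonneg _)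
          (fun j => ?_) (summable_geometric_of_lt_one (by positivity) (ht.trans_lt (by norm_num)))
        refine le_trans (le_of_eq ?_) (hb j)
        rw [← integral_const_mul]
        refine integral_congr_ae (ae_of_all _ fun ω => ?_)
        simp [abs_of_nonneg (hZ0 ω)])
    simp only [integral_const_mul] at hsum
    have hmgf : mgf Z μ t = ∫ ω, ∑' j : ℕ, t ^ j / j.factorial * Z ω ^ j ∂μ := by
      refine integral_congr_ae (ae_of_all _ fun ω => ?_)
      simp only [Real.exp_eq_exp_ℝ, NormedSpace.exp_eq_tsum_div]
      refine tsum_congr fun j => ?_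
      rw [mul_pow]; ring
    rwa [hmgf]
  have hintexp : Integrable (fun ω => Real.exp (|t| * Z ω)) μ := by
    -- Otherwise the integral would be the junk value `0`, but its series has first term `1`.
    by_contra hcon
    have h1 := (key |t| (by rwa [abs_abs])).1
    rw [mgf, integral_undef hcon] at h1
    have h2 := le_hasSum h1 0 fun j _ => mul_nonneg (by positivity)
      (integral_nonneg fun ω => pow_nonneg (hZ0 ω) j)
    norm_num at h2
  refine ⟨hintexp.mono' (by fun_prop) (ae_of_all _ fun ω => ?_), ?_⟩
  · rw [Real.norm_eq_abs, Real.abs_exp, Real.exp_le_exp]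
    exact mul_le_mul_of_nonneg_right (le_abs_self t) (hZ0 ω)
  obtain ⟨hs, hb⟩ := key t ht
  set r := L * |t| with hr
  have hr0 : 0 ≤ r := by positivity
  have hg := (hasSum_geometric_of_lt_one hr0 (ht.trans_lt (by norm_num)))
  have hs2 := (hasSum_nat_add_iff' 2).2 hs
  have hg2 := (hasSum_nat_add_iff' 2).2 hg
  have hle := hasSum_le (fun j => (le_abs_self _).trans (hb (j + 2))) hs2 hg2
  simp only [Finset.sum_range_succ, Finset.sum_range_zero, pow_zero, pow_one, Nat.factorial,
    integral_const, probReal_univ] at hle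
  have hgeo : (1 - r)⁻¹ - (0 + 1 + r) ≤ 2 * r ^ 2 := by
    have h1 : 0 < 1 - r := by linarith
    rw [sub_le_iff_le_add, inv_le_iff_one_le_mul₀ h1]
    nlinarith [mul_nonneg (sq_nonneg r) (by linarith : 0 ≤ 1 - 2 * r)]
  have hr2 : r ^ 2 = (L * t) ^ 2 := by rw [hr, mul_pow, sq_abs, mul_pow]
  have h3 := Real.add_one_le_exp (t * ∫ ω, Z ω ∂μ + 2 * (L * t) ^ 2)
  rw [← hr2] at h3 ⊢
  norm_num at hle
  linarith

/-- **Bernstein's inequality** for nonnegative variables with factorial moments and common mean. The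
level `max η (η ^ 2)` merges the Gaussian regime `η ≤ 1` and the exponential regime `η ≥ 1`. -/
theorem measureReal_sum_sub_ge_le {ι : Type*} [Fintype ι] {Z : ι → Ω → ℝ}
    (hind : iIndepFun Z μ) (hZ : ∀ i, Measurable (Z i)) (hZ0 : ∀ i ω, 0 ≤ Z i ω) {L m : ℝ}
    (hL : 0 < L) (hint : ∀ i, ∀ j : ℕ, Integrable (fun ω => Z i ω ^ j) μ)
    (hmom : ∀ i, ∀ j : ℕ, ∫ ω, Z i ω ^ j ∂μ ≤ j.factorial * L ^ j)
    (hmean : ∀ i, ∫ ω, Z i ω ∂μ = m) {η : ℝ} (hη : 0 ≤ η) :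
    μ.real {ω | (Fintype.card ι : ℝ) * (4 * L * max η (η ^ 2)) ≤ |∑ i, Z i ω - Fintype.card ι * m|} ≤
      2 * Real.exp (-(Fintype.card ι * η ^ 2)) := by
  set n : ℝ := (Fintype.card ι : ℝ) with hn
  have hn0 : 0 ≤ n := by positivity
  set ε := n * (4 * L * max η (η ^ 2)) with hε
  -- The Chernoff parameter: optimal up to constants, and capped where the generating function
  -- bound stops.
  set s : ℝ := min η 1 / (2 * L) with hsdef
  have hs0 : 0 ≤ s := by positivity
  have hLs : L * s = min η 1 / 2 := by rw [hsdef]; field_simp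
  have hLs1 : L * |s| ≤ 1 / 2 := by
    rw [abs_of_nonneg hs0, hLs]; linarith [min_le_right η 1]
  have hexpo : -s * ε + n * (2 * (L * s) ^ 2) ≤ -(n * η ^ 2) := by
    have h1 : s * ε = n * (2 * (min η 1) * max η (η ^ 2)) := by
      rw [hε, show min η 1 = 2 * (L * s) by linarith]; ring
    rw [neg_mul, h1, hLs]
    have : 2 * (min η 1 / 2) ^ 2 + η ^ 2 ≤ 2 * (min η 1) * max η (η ^ 2) := by
      rcases le_total η 1 with h | h
      · rw [min_eq_left h]; nlinarith [le_max_left η (η ^ 2)]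
      · rw [min_eq_right h]; nlinarith [le_max_right η (η ^ 2)]
    nlinarith
  have hsumfun : ∀ ω, (∑ i, Z i) ω = ∑ i, Z i ω := fun ω => Finset.sum_apply _ _ _
  have hI : ∀ t : ℝ, L * |t| ≤ 1 / 2 →
      Integrable (fun ω => Real.exp (t * (∑ i, Z i) ω)) μ ∧
      mgf (∑ i, Z i) μ t ≤ Real.exp (t * (n * m) + n * (2 * (L * t) ^ 2)) := by
    intro t ht
    have h := fun i =>
      integrable_exp_mul_and_mgf_le_of_moments (hZ i) (hZ0 i) (hint i) (hmom i) ht hL.le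
    refine ⟨hind.integrable_exp_mul_sum hZ fun i _ => (h i).1, ?_⟩
    rw [hind.mgf_sum hZ]
    refine (Finset.prod_le_prod (fun i _ => mgf_nonneg) fun i _ => (h i).2).trans_eq ?_
    simp only [hmean, Finset.prod_const, Finset.card_univ]
    rw [← Real.exp_nat_mul, ← hn]
    congr 1; ring
  have hup : μ.real {ω | n * m + ε ≤ (∑ i, Z i) ω} ≤ Real.exp (-(n * η ^ 2)) := by
    refine (measure_ge_le_exp_mul_mgf _ hs0 (hI s hLs1).1).trans ?_
    refine (mul_le_mul_of_nonneg_left (hI s hLs1).2 (Real.exp_nonneg _)).trans ?_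
    rw [← Real.exp_add, Real.exp_le_exp]
    linarith
  have hlo : μ.real {ω | (∑ i, Z i) ω ≤ n * m - ε} ≤ Real.exp (-(n * η ^ 2)) := by
    have hI' := hI (-s) (by rwa [abs_neg])
    refine (measure_le_le_exp_mul_mgf _ (by linarith) hI'.1).trans ?_
    refine (mul_le_mul_of_nonneg_left hI'.2 (Real.exp_nonneg _)).trans ?_
    rw [← Real.exp_add, Real.exp_le_exp]
    have : L * -s = -(L * s) := by ring
    rw [this, neg_sq]
    linarith
  calc μ.real {ω | ε ≤ |∑ i, Z i ω - n * m|}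
      ≤ μ.real ({ω | n * m + ε ≤ (∑ i, Z i) ω} ∪ {ω | (∑ i, Z i) ω ≤ n * m - ε}) := by
        refine measureReal_mono (fun ω hω => ?_)
        simp only [Set.mem_ofPred_eq, Set.mem_union, hsumfun] at hω ⊢
        rcases le_abs.1 hω with h | h
        · left; linarith
        · right; linarith
    _ ≤ _ := measureReal_union_le _ _
    _ ≤ _ := by linarith

/-- The growth `‖X‖_q ≤ K √q` of the moments of `X` turns into factorial growth of the moments of
`X²`, since `j ^ j ≤ j! e ^ j`. -/
theorem integrable_and_integral_sq_pow_le {X : Ω → ℝ} (hX : Measurable X) {K : ℝ} (hK : 0 < K)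
    (h : ∀ q : ℝ, 1 ≤ q → ENNReal.ofReal (q ^ (-(1 / 2) : ℝ)) *
      eLpNorm X (ENNReal.ofReal q) μ ≤ ENNReal.ofReal K) (j : ℕ) :
    Integrable (fun ω => (X ω ^ 2) ^ j) μ ∧
      ∫ ω, (X ω ^ 2) ^ j ∂μ ≤ j.factorial * (2 * Real.exp 1 * K ^ 2) ^ j := by
  rcases Nat.eq_zero_or_pos j with rfl | hj
  · simp
  have hj1 : (1 : ℝ) ≤ j := by exact_mod_cast hj
  have hq : (0 : ℝ) < 2 * j := by linarith
  have hnorm : eLpNorm X (2 * j : ℕ) μ ≤ ENNReal.ofReal (K * √(2 * j)) := by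
    have h1 := h (2 * j) (by linarith)
    have hpos : 0 < (2 * (j : ℝ)) ^ (-(1 / 2) : ℝ) := Real.rpow_pos_of_pos hq _
    rw [mul_comm, ← ENNReal.le_div_iff_mul_le (Or.inl (by simpa using hpos)) (Or.inl (by simp)),
      ← ENNReal.ofReal_div_of_pos hpos] at h1
    have h2 : ENNReal.ofReal (2 * (j : ℝ)) = ((2 * j : ℕ) : ℝ≥0∞) := by
      rw [← ENNReal.ofReal_natCast]; push_cast; rfl
    rw [h2] at h1
    convert h1 using 2
    rw [Real.rpow_neg hq.le, div_inv_eq_mul, Real.sqrt_eq_rpow]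
  have hmem : MemLp X (2 * j : ℕ) μ := ⟨hX.aestronglyMeasurable, hnorm.trans_lt (by simp)⟩
  have hfun : (fun ω => (X ω ^ 2) ^ j) = fun ω => ‖X ω‖ ^ (2 * j) := by
    ext ω; rw [← pow_mul, Real.norm_eq_abs, Even.pow_abs (by simp)]
  have hint : Integrable (fun ω => ‖X ω‖ ^ (2 * j)) μ := hmem.integrable_norm_pow (by omega)
  rw [hfun]
  refine ⟨hint, ?_⟩
  have hval : ∫ ω, ‖X ω‖ ^ (2 * j) ∂μ ≤ (K * √(2 * j)) ^ (2 * j) := by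
    rw [hmem.eLpNorm_eq_integral_rpow_norm (by simp; omega) (ENNReal.natCast_ne_top _)] at hnorm
    rw [ENNReal.ofReal_le_ofReal_iff (by positivity)] at hnorm
    simp only [ENNReal.toReal_natCast, Real.rpow_natCast] at hnorm
    have h0 : 0 ≤ ∫ ω, ‖X ω‖ ^ (2 * j) ∂μ := integral_nonneg fun ω => by positivity
    calc ∫ ω, ‖X ω‖ ^ (2 * j) ∂μ
        = ((∫ ω, ‖X ω‖ ^ (2 * j) ∂μ) ^ (((2 * j : ℕ) : ℝ)⁻¹)) ^ (2 * j) :=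
          (Real.rpow_inv_natCast_pow h0 (by omega)).symm
      _ ≤ _ := by gcongr
  refine hval.trans ?_
  have hexp := Real.pow_div_factorial_le_exp (x := (j : ℝ)) (by positivity) j
  have hjf : (0 : ℝ) < j.factorial := by exact_mod_cast j.factorial_pos
  rw [div_le_iff₀ hjf] at hexp
  calc (K * √(2 * j)) ^ (2 * j) = (2 * K ^ 2) ^ j * (j : ℝ) ^ j := by
        rw [pow_mul, mul_pow, Real.sq_sqrt hq.le, ← mul_pow]; ring_nf
    _ ≤ (2 * K ^ 2) ^ j * (Real.exp j * j.factorial) := by gcongr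
    _ = _ := by
        rw [← Real.exp_one_pow]; ring
end

/-! ### Numerical estimates -/

theorem log_one_add_le_mul_log_one_add_div {m : ℝ} (hm : 0 ≤ m) {s : ℕ} (hs : 1 ≤ s) :
    Real.log (1 + m) ≤ s * Real.log (1 + m / s) := by
  have hs0 : (0 : ℝ) < s := by exact_mod_cast hs
  rw [← Real.log_pow]
  refine Real.log_le_log (by positivity) ?_
  have hms : (0 : ℝ) ≤ m / s := by positivity
  have := one_add_mul_le_pow (a := m / s) (by linarith) s
  rwa [mul_div_cancel₀ _ hs0.ne'] at this

/-- `m.choose s ≤ (e m / s) ^ s`, read off from the term of index `s` in the binomial expansion of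
`(1 + s / m) ^ m ≤ e ^ s`. -/
theorem choose_le_exp {m s : ℕ} (hs : 1 ≤ s) (hsm : s ≤ m) :
    (m.choose s : ℝ) ≤ Real.exp (s + s * Real.log (1 + m / s)) := by
  have hs0 : (0 : ℝ) < s := by exact_mod_cast hs
  have hm0 : (0 : ℝ) < m := by exact_mod_cast hs.trans hsm
  have h1 : (m.choose s : ℝ) * (s / m) ^ s ≤ Real.exp s := by
    calc (m.choose s : ℝ) * (s / m) ^ s
        ≤ ∑ j ∈ Finset.range (m + 1), ((s : ℝ) / m) ^ j * 1 ^ (m - j) * m.choose j := by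
          have := Finset.single_le_sum
            (f := fun j => ((s : ℝ) / m) ^ j * 1 ^ (m - j) * m.choose j)
            (fun j _ => by positivity) (Finset.mem_range.2 (Nat.lt_succ_of_le hsm))
          refine le_trans (le_of_eq ?_) this
          simp [mul_comm]
      _ = ((s : ℝ) / m + 1) ^ m := (add_pow _ _ _).symm
      _ ≤ Real.exp (s / m) ^ m := by gcongr; exact Real.add_one_le_exp _
      _ = Real.exp s := by rw [← Real.exp_nat_mul]; congr 1; field_simp
  rw [Real.exp_add, ← Real.log_pow, Real.exp_log (by positivity)]
  calc (m.choose s : ℝ) = (m.choose s * (s / m) ^ s) * (m / s) ^ s := by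
        rw [mul_assoc, ← mul_pow, div_mul_div_cancel₀ hm0.ne', div_self hs0.ne', one_pow, mul_one]
    _ ≤ Real.exp s * (1 + m / s) ^ s := by gcongr; linarith

/-- The union bound over the edge sets of size `s` and their nets. The counting factors are at most
`exp (11 x)` with `x = s log (1 + m / s)`, so the surplus `16` in the exponent absorbs them and
leaves `exp (-(k + 1) x)`, where `x ≥ log m`. -/
theorem choose_mul_exp_le {m s : ℕ} (hs : 1 ≤ s) (hsm : s ≤ m) {k : ℝ} (hk : 0 < k) :
    m.choose s * (5 ^ (s + 1) * (2 * Real.exp (-((k + 16) * (s * Real.log (1 + m / s)))))) ≤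
      (m : ℝ) ^ (-(k + 1)) := by
  have hs0 : (1 : ℝ) ≤ s := by exact_mod_cast hs
  have hm0 : (0 : ℝ) < m := by exact_mod_cast hs.trans hsm
  have hlog := log_one_add_le_mul_log_one_add_div hm0.le hs
  have hch := choose_le_exp hs hsm
  set x : ℝ := s * Real.log (1 + m / s) with hx
  have hsx : (s : ℝ) ≤ 2 * x := by
    have h1 : Real.log 2 ≤ Real.log (1 + m / s) := by
      refine Real.log_le_log (by norm_num) ?_
      have : (1 : ℝ) ≤ m / s := by
        rw [one_le_div (by linarith)]; exact_mod_cast hsm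
      linarith
    have := Real.log_two_gt_d9
    nlinarith
  have h5 : (5 : ℝ) ^ (s + 1) * 2 ≤ Real.exp (4 * s) := by
    calc (5 : ℝ) ^ (s + 1) * 2 = 10 * 5 ^ s := by ring
      _ ≤ 10 ^ s * 5 ^ s := by gcongr; exact le_self_pow₀ (by norm_num) (by omega)
      _ = 50 ^ s := by rw [← mul_pow]; norm_num
      _ ≤ (Real.exp 1 ^ 4) ^ s := by
          gcongr
          calc (50 : ℝ) ≤ 2.7 ^ 4 := by norm_num
            _ ≤ _ := by gcongr; exact (by norm_num : (2.7 : ℝ) ≤ 2.7182818283).trans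
                          Real.exp_one_gt_d9.le
      _ = Real.exp (4 * s) := by
          rw [Real.exp_one_pow, ← Real.exp_nat_mul]; congr 1; push_cast; ring
  calc m.choose s * (5 ^ (s + 1) * (2 * Real.exp (-((k + 16) * x))))
      = m.choose s * (5 ^ (s + 1) * 2) * Real.exp (-((k + 16) * x)) := by ring
    _ ≤ Real.exp (s + x) * Real.exp (4 * s) * Real.exp (-((k + 16) * x)) := by gcongr
    _ = Real.exp (5 * s + x - (k + 16) * x) := by
        rw [← Real.exp_add, ← Real.exp_add]; congr 1; ring
    _ ≤ Real.exp (Real.log m * -(k + 1)) := by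
        rw [Real.exp_le_exp]
        have h2 : Real.log m ≤ x := (Real.log_le_log hm0 (by linarith)).trans hlog
        have h3 : (k + 1) * Real.log m ≤ (k + 1) * x := by gcongr
        linarith
    _ = (m : ℝ) ^ (-(k + 1)) := (Real.rpow_def_of_pos hm0 _).symm

theorem sum_nonempty_finset_exp_le {α : Type*} [Fintype α] [Nonempty α] {k : ℝ} (hk : 0 < k) :
    ∑ F : Finset α with F.Nonempty, (5 ^ (F.card + 1) * (2 * Real.exp
      (-((k + 16) * (F.card * Real.log (1 + Fintype.card α / F.card))))) : ℝ) ≤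
      (Fintype.card α : ℝ) ^ (-k) := by
  set m := Fintype.card α with hm
  have hm0 : (0 : ℝ) < m := by exact_mod_cast Fintype.card_pos
  let f : ℕ → ℝ := fun s => if s = 0 then 0 else
    5 ^ (s + 1) * (2 * Real.exp (-((k + 16) * (s * Real.log (1 + m / s)))))
  have h1 : ∑ F : Finset α with F.Nonempty, (5 ^ (F.card + 1) * (2 * Real.exp
      (-((k + 16) * (F.card * Real.log (1 + m / F.card))))) : ℝ) =
      ∑ F ∈ (Finset.univ : Finset α).powerset, f F.card := by
    rw [Finset.powerset_univ, Finset.sum_filter]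
    refine Finset.sum_congr rfl fun F _ => ?_
    by_cases hF : F = ∅
    · simp [hF, f]
    · simp [hF, f, Finset.nonempty_iff_ne_empty]
  rw [h1, Finset.sum_powerset_apply_card, Finset.card_univ, ← hm, Finset.sum_range_succ']
  calc _ ≤ ∑ s ∈ Finset.range m, (m : ℝ) ^ (-(k + 1)) + 0 := by
        refine add_le_add (Finset.sum_le_sum fun s hs => ?_) (by simp [f])
        simp only [f, Nat.add_eq_zero_iff, one_ne_zero, and_false, if_false, nsmul_eq_mul]
        exact choose_mul_exp_le (by omega) (Finset.mem_range.1 hs) hk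
    _ = (m : ℝ) ^ (-k) := by
        rw [add_zero, Finset.sum_const, Finset.card_range, nsmul_eq_mul,
          show -k = 1 + -(k + 1) by ring, Real.rpow_add hm0, Real.rpow_one]

/-- A deviation of order `max η (η ²)` of the squared norm costs only order `η` in the norm. -/
theorem bounds_of_abs_sq_sub_le {κ L η v w r : ℝ} (hκ0 : 0 < κ) (hκ1 : κ < 1) (hL : 0 < L)
    (hη : 0 ≤ η) (hv : 0 ≤ v) (hw1 : (1 - κ) ^ 2 ≤ w) (hw2 : w ≤ (1 + κ) ^ 2)
    (h : |v ^ 2 - w| ≤ 8 * L * max η (η ^ 2)) (hr : r = (1 + 8 * L / (1 - κ)) * η) :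
    1 - κ - r ≤ v ∧ v ≤ 1 + κ + r := by
  have hκ : 0 < 1 - κ := by linarith
  set c := 1 + 8 * L / (1 - κ) with hc
  have hd : 0 < 8 * L / (1 - κ) := by positivity
  have hdm : 8 * L / (1 - κ) * (1 - κ) = 8 * L := by field_simp
  have hcL : 8 * L ≤ c := by nlinarith
  have hr0 : 0 ≤ r := by rw [hr]; positivity
  obtain ⟨h1, h2⟩ := abs_le.1 h
  have hLη : 8 * L * η ≤ (1 - κ) * r := by
    have : (1 - κ) * c = (1 - κ) + 8 * L := by rw [hc, mul_add, mul_comm (1 - κ) (_ / _), hdm]; ring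
    rw [hr, ← mul_assoc, this]; nlinarith
  constructor
  · by_contra! hlt
    have hηr : η ≤ r := by rw [hr]; nlinarith
    have hmax : max η (η ^ 2) = η := max_eq_left (by nlinarith)
    rw [hmax] at h1
    nlinarith
  · refine (abs_le_of_sq_le_sq' ?_ (by linarith)).2
    have hmax : 8 * L * max η (η ^ 2) ≤ 2 * (1 + κ) * r + r ^ 2 := by
      rcases max_choice η (η ^ 2) with hm | hm <;> rw [hm]
      · nlinarith
      · have : 8 * L * η ^ 2 ≤ r ^ 2 := by
          have : 8 * L ≤ c ^ 2 := by nlinarith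
          rw [hr, mul_pow]; gcongr
        nlinarith
    nlinarith

/-! ### The sparsity function -/

section
variable {C m n : ℝ}

theorem hasDerivAt_mul_log_one_add_div (hm : 0 ≤ m) {s : ℝ} (hs : 0 < s) :
    HasDerivAt (fun s => C * s * Real.log (1 + m / s) / n)
      (C * (Real.log (1 + m / s) - m / (s + m)) / n) s := by
  have h1 : HasDerivAt (fun s : ℝ => 1 + m / s) (-m / s ^ 2) s := by
    simpa using ((hasDerivAt_const s m).div (hasDerivAt_id s) hs.ne').const_add 1
  have h2 : (1 : ℝ) + m / s ≠ 0 := by positivity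
  refine ((((hasDerivAt_id s).const_mul C).mul (h1.log h2)).div_const n).congr_deriv ?_
  have h3 : s + m ≠ 0 := by positivity
  have h4 : (1 : ℝ) + m / s = (s + m) / s := by field_simp
  simp only [id, mul_one]
  rw [show -m / s ^ 2 / (1 + m / s) = -m / (s * (s + m)) by rw [h4]; field_simp]
  field_simp
  ring

theorem hasDerivAt_log_one_add_div_sub (hm : 0 ≤ m) {s : ℝ} (hs : 0 < s) :
    HasDerivAt (fun s => C * (Real.log (1 + m / s) - m / (s + m)) / n)
      (C * (-(m ^ 2 / (s * (s + m) ^ 2))) / n) s := by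
  have h1 : HasDerivAt (fun s : ℝ => 1 + m / s) (-m / s ^ 2) s := by
    simpa using ((hasDerivAt_const s m).div (hasDerivAt_id s) hs.ne').const_add 1
  have h2 : (1 : ℝ) + m / s ≠ 0 := by positivity
  have h3 : s + m ≠ 0 := by positivity
  have h5 : HasDerivAt (fun s : ℝ => m / (s + m)) (-m / (s + m) ^ 2) s := by
    exact ((hasDerivAt_const s m).div ((hasDerivAt_id s).add_const m) h3).congr_deriv (by simp)
  refine ((((h1.log h2).sub h5).const_mul C).div_const n).congr_deriv ?_
  have h4 : (1 : ℝ) + m / s = (s + m) / s := by field_simp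
  rw [show -m / s ^ 2 / (1 + m / s) = -m / (s * (s + m)) by rw [h4]; field_simp]
  field_simp
  ring

/-- The function `s ↦ C s log (1 + m / s) / n` is admissible, and by homogeneity the isometry bounds
need only be checked on unit vectors. -/
theorem isCutRIP_of_bounds {n p : ℕ} {G : SimpleGraph (Fin p)} {A : Matrix (Fin n) (Fin p) ℝ}
    {κ C m : ℝ} (hκ : 0 < κ) (hC : 0 < C) (hm : 0 ≤ m)
    (h : ∀ x : EuclideanSpace ℝ (Fin p), 1 ≤ gradientSparsity G x → ‖x‖ = 1 →
      1 - κ - √(C * (gradientSparsity G x) * Real.log (1 + m / (gradientSparsity G x)) / n) ≤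
        ‖Matrix.toEuclideanLin A x‖ ∧ ‖Matrix.toEuclideanLin A x‖ ≤
      1 + κ + √(C * (gradientSparsity G x) * Real.log (1 + m / (gradientSparsity G x)) / n)) :
    IsCutRIP G A κ (fun s => C * s * Real.log (1 + m / s) / n) := by
  have hderiv : ∀ s : ℝ, 0 < s → deriv (fun s => C * s * Real.log (1 + m / s) / n) =ᶠ[nhds s]
      fun s => C * (Real.log (1 + m / s) - m / (s + m)) / n := fun s hs => by
    filter_upwards [lt_mem_nhds hs] with t ht
    exact (hasDerivAt_mul_log_one_add_div hm ht).deriv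
  refine ⟨hκ, fun s hs => ?_, fun s hs => (hasDerivAt_mul_log_one_add_div hm hs).differentiableAt,
    fun s hs => ((hderiv s hs).differentiableAt_iff).2
      (hasDerivAt_log_one_add_div_sub hm hs).differentiableAt, fun s hs => ?_, fun s hs => ?_,
    fun x hx => ?_⟩
  · have : 0 ≤ m / s := by positivity
    have := Real.log_nonneg (by linarith : 1 ≤ 1 + m / s)
    positivity
  · rw [(hasDerivAt_mul_log_one_add_div hm hs).deriv]
    have h1 : m / (s + m) ≤ Real.log (1 + m / s) := by
      have h2 := Real.one_sub_inv_le_log_of_pos (x := 1 + m / s) (by positivity)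
      have h3 : 0 < s + m := by positivity
      have h4 : 1 - (1 + m / s)⁻¹ = m / (s + m) := by
        rw [show (1 : ℝ) + m / s = (s + m) / s by field_simp]; field_simp; ring
      linarith
    have : 0 ≤ Real.log (1 + m / s) - m / (s + m) := by linarith
    positivity
  · rw [(hderiv s hs).deriv_eq, (hasDerivAt_log_one_add_div_sub hm hs).deriv, mul_neg, neg_div]
    exact neg_nonpos.2 (by positivity)
  · have hx0 : x ≠ 0 := by
      rintro rfl
      have : discreteGradient G 0 = 0 := by ext e; simp [discreteGradient]
      simp [gradientSparsity, this] at hx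
    have hn : 0 < ‖x‖ := norm_pos_iff.2 hx0
    have hs : gradientSparsity G (‖x‖⁻¹ • x) = gradientSparsity G x := by
      have : discreteGradient G (‖x‖⁻¹ • x) = ‖x‖⁻¹ • discreteGradient G x := by
        ext e; simp [discreteGradient, mul_sub]
      rw [gradientSparsity, gradientSparsity, this,
        Function.support_const_smul_of_ne_zero _ _ (by positivity)]
    have hu := h (‖x‖⁻¹ • x) (by rwa [hs]) (by simp [norm_smul, hn.ne'])
    rw [hs, map_smul, norm_smul, norm_inv, norm_norm] at hu
    rw [inv_mul_eq_div, le_div_iff₀ hn, div_le_iff₀ hn] at hu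
    exact hu
end

/-! ### Signals with gradient supported on a set of edges -/

/-- The signals whose discrete gradient vanishes off a given set `F` of edges. -/
def cutSpace {p : ℕ} (G : SimpleGraph (Fin p)) (F : Finset G.edgeSet) :
    Submodule ℝ (EuclideanSpace ℝ (Fin p)) where
  carrier := {x | ∀ e ∉ F, discreteGradient G x e = 0}
  zero_mem' := fun e _ => by simp [discreteGradient]
  add_mem' := fun {x y} hx hy e he => by
    have h1 := hx e he
    have h2 := hy e he
    simp only [discreteGradient, PiLp.add_apply] at *
    linarith
  smul_mem' := fun c x hx e he => by
    have h1 := hx e he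
    simp only [discreteGradient, PiLp.smul_apply, smul_eq_mul] at *
    rw [← mul_sub, h1, mul_zero]

theorem eq_of_discreteGradient_eq_zero {p : ℕ} {G : SimpleGraph (Fin p)} (hG : G.Connected)
    {x : EuclideanSpace ℝ (Fin p)} (hx : ∀ e, discreteGradient G x e = 0) (i j : Fin p) :
    x i = x j := by
  have hadj : ∀ i j, G.Adj i j → x i = x j := by
    intro i j hij
    have h := hx ⟨s(i, j), hij⟩
    simp only [discreteGradient, Sym2.inf_mk, Sym2.sup_mk] at h
    rcases le_total i j with hle | hle
    · rw [inf_eq_left.2 hle, sup_eq_right.2 hle] at h; linarith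
    · rw [inf_eq_right.2 hle, sup_eq_left.2 hle] at h; linarith
  obtain ⟨w⟩ := hG.preconnected i j
  induction w with
  | nil => rfl
  | cons h _ ih => exact (hadj _ _ h).trans ih

theorem finrank_cutSpace_le {p : ℕ} {G : SimpleGraph (Fin p)} (hG : G.Connected)
    (F : Finset G.edgeSet) : Module.finrank ℝ (cutSpace G F) ≤ F.card + 1 := by
  obtain ⟨i₀⟩ := hG.nonempty
  -- A signal in the space is determined by its value at one vertex and its gradient on `F`.
  let T : cutSpace G F →ₗ[ℝ] ℝ × (F → ℝ) :=
    { toFun := fun x => (x.1 i₀, fun e => discreteGradient G x.1 e.1)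
      map_add' := fun x y => by
        ext <;> simp [discreteGradient]; ring
      map_smul' := fun c x => by
        ext <;> simp [discreteGradient]; ring }
  have hT : Function.Injective T := by
    rw [injective_iff_map_eq_zero]
    rintro ⟨x, hx⟩ h
    have h1 : x i₀ = 0 := congrArg Prod.fst h
    have h2 : ∀ e : F, discreteGradient G x e.1 = 0 := fun e => congrFun (congrArg Prod.snd h) e
    have h3 : ∀ e, discreteGradient G x e = 0 := fun e => by
      by_cases he : e ∈ F
      exacts [h2 ⟨e, he⟩, hx e he]
    ext i
    simpa [h1] using eq_of_discreteGradient_eq_zero hG h3 i i₀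
  have := LinearMap.finrank_le_finrank_of_injective hT
  simpa [add_comm] using this

theorem exists_mem_cutSpace {p : ℕ} (G : SimpleGraph (Fin p)) (x : EuclideanSpace ℝ (Fin p)) :
    ∃ F : Finset G.edgeSet, F.card = gradientSparsity G x ∧ x ∈ cutSpace G F := by
  classical
  have : Fintype G.edgeSet := Fintype.ofFinite _
  refine ⟨(Function.support (discreteGradient G x)).toFinset, ?_, fun e he => ?_⟩
  · rw [gradientSparsity, Set.ncard_eq_toFinset_card']
  · simpa using he

/-! ### Covariance matrices and the design matrix -/

theorem Matrix.IsHermitian.inner_toEuclideanLin_nonneg {ι : Type*} [Fintype ι] [DecidableEq ι]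
    {M : Matrix ι ι ℝ} (hM : M.IsHermitian)
    (h : ∀ θ : ℝ, Module.End.HasEigenvalue (Matrix.toLin' M) θ → 0 ≤ θ)
    (y : EuclideanSpace ℝ ι) : 0 ≤ inner ℝ (Matrix.toEuclideanLin M y) y := by
  have hps : M.PosSemidef := hM.posSemidef_iff_eigenvalues_nonneg.2 fun i => by
    refine h _ (Module.End.hasEigenvalue_of_hasEigenvector
      (x := (hM.eigenvectorBasis i : ι → ℝ)) ⟨Module.End.mem_eigenspace_iff.2 ?_, fun h0 => ?_⟩)
    · rw [Matrix.toLin'_apply]; exact hM.mulVec_eigenvectorBasis i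
    · exact hM.eigenvectorBasis.orthonormal.ne_zero i (by ext j; exact congrFun h0 j)
  have := hps.re_dotProduct_nonneg (y : ι → ℝ)
  simpa [EuclideanSpace.inner_eq_star_dotProduct, Matrix.toLpLin_apply] using this

theorem Matrix.IsHermitian.inner_toEuclideanLin_mem_Icc {ι : Type*} [Fintype ι] [DecidableEq ι]
    {M : Matrix ι ι ℝ} (hM : M.IsHermitian) {lo hi : ℝ}
    (h : ∀ θ : ℝ, Module.End.HasEigenvalue (Matrix.toLin' M) θ → lo ≤ θ ∧ θ ≤ hi)
    {y : EuclideanSpace ℝ ι} (hy : ‖y‖ = 1) :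
    inner ℝ (Matrix.toEuclideanLin M y) y ∈ Set.Icc lo hi := by
  have h1 : ∀ c : ℝ, (c • (1 : Matrix ι ι ℝ)).IsHermitian := fun c => by
    simp [Matrix.IsHermitian]
  have hyy : inner ℝ y y = (1 : ℝ) := by rw [real_inner_self_eq_norm_sq, hy, one_pow]
  have hone : ∀ c : ℝ, Matrix.toEuclideanLin (c • (1 : Matrix ι ι ℝ)) y = c • y := fun c => by
    simp
  have hlo := (hM.sub (h1 lo)).inner_toEuclideanLin_nonneg (fun θ hθ => ?_) y
  have hhi := ((h1 hi).sub hM).inner_toEuclideanLin_nonneg (fun θ hθ => ?_) y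
  · rw [map_sub, LinearMap.sub_apply, inner_sub_left, hone, inner_smul_left, hyy] at hlo hhi
    simp only [conj_trivial, mul_one] at hlo hhi
    exact ⟨by linarith, by linarith⟩
  · obtain ⟨v, hv⟩ := hθ.exists_hasEigenvector
    have hv1 := hv.apply_eq_smul
    simp only [Matrix.toLin'_apply, Matrix.sub_mulVec, Matrix.smul_mulVec, Matrix.one_mulVec]
      at hv1
    have := (h (hi - θ) (Module.End.hasEigenvalue_of_hasEigenvector (x := v)
      ⟨Module.End.mem_eigenspace_iff.2 ?_, hv.2⟩)).2
    · linarith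
    · rw [Matrix.toLin'_apply, sub_smul, ← hv1]; abel
  · obtain ⟨v, hv⟩ := hθ.exists_hasEigenvector
    have hv1 := hv.apply_eq_smul
    simp only [Matrix.toLin'_apply, Matrix.sub_mulVec, Matrix.smul_mulVec, Matrix.one_mulVec]
      at hv1
    have := (h (θ + lo) (Module.End.hasEigenvalue_of_hasEigenvector (x := v)
      ⟨Module.End.mem_eigenspace_iff.2 ?_, hv.2⟩)).1
    · linarith
    · rw [Matrix.toLin'_apply, add_smul, ← hv1]; abel

theorem isHermitian_covarianceMatrix {Ω : Type*} [MeasurableSpace Ω] {p : ℕ}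
    (a : Ω → EuclideanSpace ℝ (Fin p)) (μ : Measure Ω) : (covarianceMatrix a μ).IsHermitian := by
  ext i j
  simp [covarianceMatrix, covariance_comm]

section
variable {Ω : Type*} [MeasurableSpace Ω] {μ : Measure Ω} [IsProbabilityMeasure μ] {p : ℕ}

theorem integral_inner_sq_eq {a : Ω → EuclideanSpace ℝ (Fin p)} (ha : MemLp a 2 μ)
    (hmean : ∫ ω, a ω ∂μ = 0) (y : EuclideanSpace ℝ (Fin p)) :
    ∫ ω, inner ℝ y (a ω) ^ 2 ∂μ =
      inner ℝ (Matrix.toEuclideanLin (covarianceMatrix a μ) y) y := by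
  have hmem : MemLp (fun ω => inner ℝ y (a ω)) 2 μ := ha.const_inner y
  have h0 : ∫ ω, inner ℝ y (a ω) ∂μ = 0 := by
    rw [integral_inner (ha.integrable (by norm_num)), hmean, inner_zero_right]
  have h1 : ∫ ω, inner ℝ y (a ω) ^ 2 ∂μ =
      cov[fun ω => inner ℝ y (a ω), fun ω => inner ℝ y (a ω); μ] := by
    rw [covariance_eq_sub hmem hmem, h0]
    simp [sq]
  have h2 : (fun ω => inner ℝ y (a ω)) = fun ω => ∑ i, y i * a ω i := by
    ext ω; simp [PiLp.inner_apply, mul_comm]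
  have hco : ∀ i, MemLp (fun ω => y i * a ω i) 2 μ := fun i => (ha.eval_piLp i).const_mul _
  rw [h1, h2, covariance_fun_sum_fun_sum hco hco]
  simp only [covariance_const_mul_left, covariance_const_mul_right, PiLp.inner_apply,
    Matrix.toLpLin_apply, Matrix.mulVec, dotProduct, covarianceMatrix, Matrix.of_apply]
  refine Finset.sum_congr rfl fun i _ => ?_
  simp only [RCLike.inner_apply, conj_trivial, Finset.mul_sum]
  refine Finset.sum_congr rfl fun j _ => ?_
  ring

theorem norm_sq_toEuclideanLin_designMatrix {n : ℕ} (a : Fin n → EuclideanSpace ℝ (Fin p))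
    (y : EuclideanSpace ℝ (Fin p)) :
    ‖Matrix.toEuclideanLin (designMatrix a) y‖ ^ 2 = (∑ i, inner ℝ y (a i) ^ 2) / n := by
  rw [EuclideanSpace.norm_sq_eq, Finset.sum_div]
  refine Finset.sum_congr rfl fun i _ => ?_
  have : (Matrix.toEuclideanLin (designMatrix a) y) i = inner ℝ y (a i) / √(n : ℝ) := by
    simp only [Matrix.toLpLin_apply, Matrix.mulVec, dotProduct, designMatrix,
      Matrix.of_apply, PiLp.inner_apply, RCLike.inner_apply, conj_trivial, Finset.sum_div]
    exact Finset.sum_congr rfl fun j _ => by ring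
  rw [this, Real.norm_eq_abs, sq_abs, div_pow, Real.sq_sqrt (Nat.cast_nonneg n)]
end

/-! ### Deviation of the squared norm -/

theorem mul_eLpNorm_inner_le_of_subGaussianNorm_le {Ω : Type*} [MeasurableSpace Ω] {μ : Measure Ω}
    {p : ℕ} {a : Ω → EuclideanSpace ℝ (Fin p)} {c : ℝ≥0∞} (h : subGaussianNorm a μ ≤ c)
    {u : EuclideanSpace ℝ (Fin p)} (hu : ‖u‖ = 1) {q : ℝ} (hq : 1 ≤ q) :
    ENNReal.ofReal (q ^ (-(1 / 2) : ℝ)) *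
      eLpNorm (fun ω => inner ℝ u (a ω)) (ENNReal.ofReal q) μ ≤ c := by
  simp only [subGaussianNorm, iSup_le_iff] at h
  exact h u hu q hq

theorem memLp_two_of_subGaussianNorm_le {Ω : Type*} [MeasurableSpace Ω] {μ : Measure Ω} {p : ℕ}
    {a : Ω → EuclideanSpace ℝ (Fin p)} (ha : Measurable a) {K : ℝ}
    (h : subGaussianNorm a μ ≤ ENNReal.ofReal K) : MemLp a 2 μ := by
  refine MemLp.of_eval_piLp fun i => ⟨by fun_prop, ?_⟩
  have h1 := mul_eLpNorm_inner_le_of_subGaussianNorm_le h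
    (u := EuclideanSpace.single i 1) (by simp) one_le_two
  have h2 : (fun ω => inner ℝ (EuclideanSpace.single i (1 : ℝ)) (a ω)) = fun ω => a ω i := by
    ext ω; simp [EuclideanSpace.inner_single_left]
  rw [h2, ENNReal.ofReal_ofNat] at h1
  by_contra hcon
  rw [not_lt, top_le_iff] at hcon
  have h3 : ENNReal.ofReal ((2 : ℝ) ^ (-(1 / 2) : ℝ)) ≠ 0 := by
    simp only [ne_eq, ENNReal.ofReal_eq_zero, not_le]; positivity
  rw [hcon, ENNReal.mul_top h3] at h1
  exact absurd h1 (by simp)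

/-- The deviation bound for the squared norm of the image of a single unit vector. -/
theorem measureReal_norm_sq_designMatrix_sub_ge_le {Ω : Type*} [MeasurableSpace Ω] {μ : Measure Ω}
    [IsProbabilityMeasure μ] {n p : ℕ} (hn : 1 ≤ n) {a : Fin n → Ω → EuclideanSpace ℝ (Fin p)}
    {Sig : Matrix (Fin p) (Fin p) ℝ} {K : ℝ} (hK : 0 < K) (ha : ∀ i, Measurable (a i))
    (hind : iIndepFun a μ) (hmean : ∀ i, ∫ ω, a i ω ∂μ = 0)
    (hcov : ∀ i, covarianceMatrix (a i) μ = Sig)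
    (hsub : ∀ i, subGaussianNorm (a i) μ ≤ ENNReal.ofReal K)
    {y : EuclideanSpace ℝ (Fin p)} (hy : ‖y‖ = 1) {η : ℝ} (hη : 0 ≤ η) :
    μ.real {ω | 4 * (2 * Real.exp 1 * K ^ 2) * max η (η ^ 2) ≤
      |‖Matrix.toEuclideanLin (designMatrix fun i => a i ω) y‖ ^ 2 -
        inner ℝ (Matrix.toEuclideanLin Sig y) y|} ≤ 2 * Real.exp (-(n * η ^ 2)) := by
  have hX : ∀ i, Measurable fun ω => inner ℝ y (a i ω) := fun i => by
    have := ha i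
    fun_prop
  have hmom := fun i => integrable_and_integral_sq_pow_le (μ := μ) (hX i) hK fun q hq =>
    mul_eLpNorm_inner_le_of_subGaussianNorm_le (hsub i) hy hq
  have hind' : iIndepFun (fun i ω => inner ℝ y (a i ω) ^ 2) μ :=
    hind.comp (fun _ v => inner ℝ y v ^ 2) fun _ => by fun_prop
  have hmean' : ∀ i, ∫ ω, inner ℝ y (a i ω) ^ 2 ∂μ = inner ℝ (Matrix.toEuclideanLin Sig y) y :=
    fun i => by
      rw [integral_inner_sq_eq (memLp_two_of_subGaussianNorm_le (ha i) (hsub i)) (hmean i), hcov i]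
  have h := measureReal_sum_sub_ge_le hind' (fun i => (hX i).pow_const 2)
    (fun i ω => sq_nonneg _) (L := 2 * Real.exp 1 * K ^ 2) (by positivity)
    (fun i j => (hmom i j).1) (fun i j => (hmom i j).2) hmean' hη
  rw [Fintype.card_fin] at h
  convert h using 4 with ω
  have hn0 : (0 : ℝ) < n := by exact_mod_cast hn
  rw [norm_sq_toEuclideanLin_designMatrix, ← mul_le_mul_iff_right₀ hn0]
  conv_lhs => rhs; rw [← abs_of_pos hn0, ← abs_mul, mul_sub, abs_of_pos hn0,
    mul_div_cancel₀ _ hn0.ne']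

/-- If the squared norm of `A y` is close to the quadratic form of `S` on a `1 / 2`-net of the unit
sphere of a subspace, then it is so on the whole unit sphere of the subspace. -/
theorem abs_norm_sq_sub_le_of_net {n p : ℕ} (A : Matrix (Fin n) (Fin p) ℝ)
    (S : Matrix (Fin p) (Fin p) ℝ) (V : Submodule ℝ (EuclideanSpace ℝ (Fin p))) {N : Finset V}
    (hN : ∀ y ∈ N, ‖y‖ = 1) (hnet : ∀ x : V, ‖x‖ = 1 → ∃ y ∈ N, ‖x - y‖ ≤ 1 / 2) {t : ℝ}
    (ht : ∀ y ∈ N, |‖Matrix.toEuclideanLin A y‖ ^ 2 -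
      inner ℝ (Matrix.toEuclideanLin S y) (y : EuclideanSpace ℝ (Fin p))| ≤ t)
    {x : EuclideanSpace ℝ (Fin p)} (hxV : x ∈ V) (hx : ‖x‖ = 1) :
    |‖Matrix.toEuclideanLin A x‖ ^ 2 - inner ℝ (Matrix.toEuclideanLin S x) x| ≤ 2 * t := by
  let B : LinearMap.BilinForm ℝ V :=
    (((innerₗ _).compl₁₂ (Matrix.toEuclideanLin A) (Matrix.toEuclideanLin A)) -
      (innerₗ _).comp (Matrix.toEuclideanLin S)).domRestrict₁₂ V V
  have hB : ∀ v : V, B v v = ‖Matrix.toEuclideanLin A v‖ ^ 2 -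
      inner ℝ (Matrix.toEuclideanLin S v) (v : EuclideanSpace ℝ (Fin p)) := fun v => by
    rw [← real_inner_self_eq_norm_sq]
    rfl
  have := abs_bilinForm_self_le_of_net B hN hnet (fun y hy => (hB y).symm ▸ ht y hy)
    (x := ⟨x, hxV⟩) hx
  rwa [hB] at this

/-! ### The union bound -/

theorem proposition1 (K κ k : ℝ) (hK : 0 < K) (hκ0 : 0 < κ) (hκ1 : κ < 1) (hk : 0 < k) :
    ∃ C : ℝ, 0 < C ∧
      ∀ (n p : ℕ), 1 ≤ n → 3 ≤ p →
      ∀ (G : SimpleGraph (Fin p)), G.Connected →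
      ∀ (Ω : Type*) [MeasurableSpace Ω] (μ : Measure Ω) [IsProbabilityMeasure μ]
        (a : Fin n → Ω → EuclideanSpace ℝ (Fin p)) (Sig : Matrix (Fin p) (Fin p) ℝ),
        (∀ i, Measurable (a i)) →
        iIndepFun a μ →
        (∀ i j, IdentDistrib (a i) (a j) μ μ) →
        (∀ i, ∫ ω, a i ω ∂μ = 0) →
        (∀ i, covarianceMatrix (a i) μ = Sig) →
        (∀ i, subGaussianNorm (a i) μ ≤ ENNReal.ofReal K) →
        (∀ θ : ℝ, Module.End.HasEigenvalue (Matrix.toLin' Sig) θ →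
          (1 - κ) ^ 2 ≤ θ ∧ θ ≤ (1 + κ) ^ 2) →
        1 - (G.edgeSet.ncard : ℝ) ^ (-k) ≤
          μ.real {ω | IsCutRIP G (designMatrix fun i => a i ω) κ
            (fun s => C * s * Real.log (1 + (G.edgeSet.ncard : ℝ) / s) / n)} := by
  have hκ : 0 < 1 - κ := by linarith
  set L : ℝ := 2 * Real.exp 1 * K ^ 2 with hLdef
  have hL : 0 < L := by positivity
  set c : ℝ := 1 + 8 * L / (1 - κ) with hc
  have hc0 : 0 < c := by positivity
  refine ⟨c ^ 2 * (k + 16), by positivity, ?_⟩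
  intro n p hn hp G hG Ω _ μ _ a Sig ha hind _ hmean hcov hsub heig
  classical
  have : Fintype G.edgeSet := Fintype.ofFinite _
  have hn0 : (0 : ℝ) < n := by exact_mod_cast hn
  rw [← Nat.card_coe_set_eq, Nat.card_eq_fintype_card]
  set m := Fintype.card G.edgeSet with hm
  have : Nontrivial (Fin p) := Fin.nontrivial_iff_two_le.2 (by omega)
  have hE : Nonempty G.edgeSet := by
    obtain ⟨j, hj⟩ := hG.preconnected.exists_adj_of_nontrivial ⟨0, by omega⟩
    exact ⟨⟨s(_, j), hj⟩⟩
  have hSig : Sig.IsHermitian := hcov ⟨0, hn⟩ ▸ isHermitian_covarianceMatrix _ μ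
  -- The deviation allowed on signals whose gradient is supported on `s` edges.
  let η : ℕ → ℝ := fun s => √((k + 16) * (s * Real.log (1 + m / s)) / n)
  have hlog : ∀ s : ℕ, 0 ≤ (s : ℝ) * Real.log (1 + m / s) := fun s =>
    mul_nonneg s.cast_nonneg (Real.log_nonneg (by
      have : (0 : ℝ) ≤ m / s := by positivity
      linarith))
  have hη2 : ∀ s, n * η s ^ 2 = (k + 16) * (s * Real.log (1 + m / s)) := fun s => by
    have := hlog s
    rw [Real.sq_sqrt (by positivity), mul_div_cancel₀ _ hn0.ne']
  choose N hN1 hNcard hNnet using fun F : Finset G.edgeSet =>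
    exists_half_net_unit_sphere (cutSpace G F)
  let bad : Finset G.edgeSet → EuclideanSpace ℝ (Fin p) → Set Ω := fun F y =>
    {ω | 4 * L * max (η F.card) (η F.card ^ 2) ≤
      |‖Matrix.toEuclideanLin (designMatrix fun i => a i ω) y‖ ^ 2 -
        inner ℝ (Matrix.toEuclideanLin Sig y) y|}
  set good := {ω | IsCutRIP G (designMatrix fun i => a i ω) κ
    (fun s => c ^ 2 * (k + 16) * s * Real.log (1 + (m : ℝ) / s) / n)} with hgood
  have hsubset : goodᶜ ⊆ ⋃ F ∈ (Finset.univ.filter Finset.Nonempty : Finset (Finset G.edgeSet)),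
      ⋃ y ∈ N F, bad F y := by
    intro ω hω
    by_contra hcon
    refine hω (isCutRIP_of_bounds hκ0 (by positivity) (by positivity) fun x hx hx1 => ?_)
    obtain ⟨F, hF, hxF⟩ := exists_mem_cutSpace G x
    have hFne : F.Nonempty := Finset.card_pos.1 (by omega)
    have hdev := abs_norm_sq_sub_le_of_net (designMatrix fun i => a i ω) Sig (cutSpace G F) (hN1 F)
      (hNnet F) (t := 4 * L * max (η F.card) (η F.card ^ 2)) (fun y hy => by
        by_contra! hlt
        refine hcon (Set.mem_biUnion (by simpa using hFne) (Set.mem_biUnion hy ?_))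
        exact hlt.le) hxF hx1
    have hmem := hSig.inner_toEuclideanLin_mem_Icc heig hx1
    rw [← hF]
    refine bounds_of_abs_sq_sub_le (η := η F.card) hκ0 hκ1 hL (Real.sqrt_nonneg _) (norm_nonneg _)
      hmem.1 hmem.2 (hdev.trans_eq (by ring)) ?_
    rw [← hc, show c ^ 2 * (k + 16) * F.card * Real.log (1 + m / F.card) / n =
      c ^ 2 * ((k + 16) * (F.card * Real.log (1 + m / F.card)) / n) by ring,
      Real.sqrt_mul (by positivity), Real.sqrt_sq hc0.le]
  have hbad : μ.real goodᶜ ≤ (m : ℝ) ^ (-k) := by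
    calc μ.real goodᶜ ≤ _ := measureReal_mono hsubset (measure_ne_top _ _)
      _ ≤ ∑ F : Finset G.edgeSet with F.Nonempty, μ.real (⋃ y ∈ N F, bad F y) :=
          measureReal_biUnion_finset_le _ _
      _ ≤ ∑ F : Finset G.edgeSet with F.Nonempty, (5 ^ (F.card + 1) * (2 * Real.exp
            (-((k + 16) * (F.card * Real.log (1 + m / F.card))))) : ℝ) := by
          refine Finset.sum_le_sum fun F _ => ?_
          calc μ.real (⋃ y ∈ N F, bad F y) ≤ ∑ y ∈ N F, μ.real (bad F y) :=
                measureReal_biUnion_finset_le _ _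
            _ ≤ ∑ y ∈ N F, 2 * Real.exp (-((k + 16) * (F.card * Real.log (1 + m / F.card)))) := by
                refine Finset.sum_le_sum fun y hy => ?_
                rw [← hη2]
                exact measureReal_norm_sq_designMatrix_sub_ge_le hn hK ha hind hmean hcov hsub
                  (hN1 F y hy) (Real.sqrt_nonneg _)
            _ ≤ _ := by
                rw [Finset.sum_const, nsmul_eq_mul]
                gcongr
                calc ((N F).card : ℝ) ≤ 5 ^ Module.finrank ℝ (cutSpace G F) := by
                      exact_mod_cast hNcard F
                  _ ≤ 5 ^ (F.card + 1) := by
                      gcongr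
                      · norm_num
                      · exact finrank_cutSpace_le hG F
      _ ≤ _ := sum_nonempty_finset_exp_le hk
  -- Subadditivity suffices here, so measurability of `good` is not needed.
  have hone : 1 ≤ μ.real good + μ.real goodᶜ := by
    have := measureReal_union_le (μ := μ) good goodᶜ
    rwa [Set.union_compl_self, probReal_univ] at this
  linarith
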